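/- Let $1\le p\le 2$, let $f\in L_p(\mathbb R)$ (real or complex scalars), and let $(\lambda_i)_{i=1}^\infty$ be a sequence of real numbers. Write $T_\lambda f(x)=f(x-\lambda)$, and let $X_p(f,(\lambda_i))$ denote the closed linear span of $\{T_{\lambda_i}f : i\in\mathbb N\}$ in $L_p(\mathbb R)$. Suppose that $(T_{\lambda_i}f)_{i=1}^\infty$ is an unconditional basic sequence in $L_p(\mathbb R)$, that is, an unconditional Schauder basis of $X_p(f,(\lambda_i))$. Then for every bounded interval $I\subseteq\mathbb R$ the restriction operator $T_I: X_p(f,(\lambda_i))\to L_p(I)$, $x\mapsto x|_I$, is compact. -/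

import Mathlib

open MeasureTheory
open scoped ENNReal

noncomputable section

namespace TranslateLp

variable {𝕜 : Type*} [RCLike 𝕜]

/-- A sequence in a normed space is unconditional basic if it is an unconditional Schauder basis
of its closed linear span. -/
def IsUnconditionalBasic (𝕜 : Type*) [RCLike 𝕜] {E : Type*} [NormedAddCommGroup E]
    [NormedSpace 𝕜 E] (x : ℕ → E) : Prop :=
  ∃ b : UnconditionalSchauderBasis ℕ 𝕜 (Submodule.span 𝕜 (Set.range x)).topologicalClosure,
    ∀ i, (b i : E) = x i

/-- The translation operator `(T_t f)(x) = f (x - t)` on `L_p(ℝ)`. -/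
def translateOp {p : ℝ≥0∞} (t : ℝ) (f : Lp 𝕜 p (volume : Measure ℝ)) :
    Lp 𝕜 p (volume : Measure ℝ) :=
  Lp.compMeasurePreserving (fun x : ℝ => x - t) (measurePreserving_sub_right volume t) f

/-- `X_p(f, (lam i))`: the closed linear span in `L_p(ℝ)` of the translates `T_{lam i} f`. -/
def translateSpan {p : ℝ≥0∞} [Fact (1 ≤ p)] (f : Lp 𝕜 p (volume : Measure ℝ)) (lam : ℕ → ℝ) :
    Submodule 𝕜 (Lp 𝕜 p (volume : Measure ℝ)) :=
  (Submodule.span 𝕜 (Set.range fun i => translateOp (lam i) f)).topologicalClosure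

/-- The restriction operator `x ↦ x|_I` from a subspace `X` of `L_p(ℝ)` to `L_p(I)`. -/
def restrictOp {p : ℝ≥0∞} [Fact (1 ≤ p)] (X : Submodule 𝕜 (Lp 𝕜 p (volume : Measure ℝ)))
    (I : Set ℝ) : X →L[𝕜] Lp 𝕜 p ((volume : Measure ℝ).restrict I) :=
  (LpToLpRestrictCLM ℝ 𝕜 𝕜 volume p I).comp X.subtypeL

end TranslateLp

end

/-!
The restriction operator is the norm limit of its compositions with the finite-rank basis
projections, because of a tail estimate which pairs two square-summable sequences.

*Coefficients.* For `1 ≤ p ≤ 2` the space `L_p` has cotype 2: if all signed sums `∑ ± v i` have norm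
at most `R`, then `(∑ ‖v i‖²)^{1/2} ≤ 2 R` (`sqrt_sum_norm_sq_le_of_norm_signedSum_le`). This
follows from the `L_1` Khintchine inequality applied at almost every point and Jensen's
inequality. The projections of an unconditional basis onto finite sets of basis vectors are
uniformly bounded, so the signed sums of the terms of `x = ∑ a i • T_{lam i} f` are bounded by a
multiple of `‖x‖`; as all translates have norm `‖f‖ > 0`, this gives `(∑ |a i|²)^{1/2} ≤ C ‖x‖`
(`sqrt_sum_norm_coord_sq_le`).

*Restricted translates.* Boundedness of the projections also bounds `‖T_{lam i} f - T_{lam j} f‖`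
from below for `i ≠ j`, and translation is continuous on `L_p`, so the `lam i` are uniformly
separated (`exists_le_abs_sub_of_isUnconditionalBasic`). Hence the intervals `I - lam i` overlap
boundedly often, and `∑ ‖(T_{lam i} f)|_I‖^p ≤ M ‖f‖^p`
(`sum_norm_restrict_translateOp_rpow_le`). Since `p ≤ 2`, the numbers `‖(T_{lam i} f)|_I‖` are
square-summable.

By Cauchy–Schwarz, `‖∑_{i ∉ F} a i • (T_{lam i} f)|_I‖` is at most `C ‖x‖` times the `ℓ_2` norm
of the tail of that sequence, which is small uniformly on the unit ball
(`isCompactOperator_of_sqrt_sum_coord_sq_le`).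
-/

open Filter Topology

namespace TranslateLp

/-! ### Khintchine's inequality -/

section
variable {H ι : Type*} [NormedAddCommGroup H]

/-- The sum `∑ i ∈ F, ± v i` with sign `+` exactly for `i ∈ T`. Choices of signs on `F` are encoded
by the subsets `T` of `F`, so that averaging over signs is averaging over `F.powerset`. -/
def signedSum {G ι : Type*} [AddCommGroup G] [DecidableEq ι] (v : ι → G) (F T : Finset ι) : G :=
  ∑ i ∈ F, if i ∈ T then v i else -v i

lemma sum_powerset_insert_signedSum {G : Type*} [AddCommGroup G] [DecidableEq ι] (v : ι → G)
    (φ : G → ℝ) {F : Finset ι} {j : ι} (hj : j ∉ F) :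
    ∑ T ∈ (insert j F).powerset, φ (signedSum v (insert j F) T) =
      ∑ T ∈ F.powerset, (φ (signedSum v F T + v j) + φ (signedSum v F T - v j)) := by
  rw [Finset.sum_powerset_insert hj, ← Finset.sum_add_distrib]
  refine Finset.sum_congr rfl fun T hT => ?_
  have hjT : j ∉ T := fun h => hj (Finset.mem_powerset.1 hT h)
  have h1 : signedSum v (insert j F) T = signedSum v F T - v j := by
    simp [signedSum, Finset.sum_insert hj, hjT]; abel
  have h2 : signedSum v (insert j F) (insert j T) = signedSum v F T + v j := by
    simp only [signedSum, Finset.sum_insert hj, Finset.mem_insert_self, if_true]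
    rw [add_comm]
    congr 1
    refine Finset.sum_congr rfl fun i hi => ?_
    have : i ≠ j := fun h => hj (h ▸ hi)
    simp [this]
  rw [h1, h2, add_comm]

/-- Second moment: the average of `‖∑ ± v i‖²` over the signs is `∑ ‖v i‖²`. -/
lemma sum_powerset_norm_signedSum_sq (𝕜 : Type*) [RCLike 𝕜] [InnerProductSpace 𝕜 H]
    [DecidableEq ι] (v : ι → H) (F : Finset ι) :
    ∑ T ∈ F.powerset, ‖signedSum v F T‖ ^ 2 = 2 ^ F.card * ∑ i ∈ F, ‖v i‖ ^ 2 := by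
  induction F using Finset.induction_on with
  | empty => simp [signedSum]
  | insert j F hj ih =>
    rw [sum_powerset_insert_signedSum v (fun x => ‖x‖ ^ 2) hj]
    have h (s : H) : ‖s + v j‖ ^ 2 + ‖s - v j‖ ^ 2 = 2 * ‖s‖ ^ 2 + 2 * ‖v j‖ ^ 2 := by
      linarith [parallelogram_law_with_norm 𝕜 s (v j)]
    simp only [h, Finset.sum_add_distrib, ← Finset.mul_sum, ih, Finset.sum_insert hj,
      Finset.card_insert_of_notMem hj, Finset.sum_const, Finset.card_powerset, nsmul_eq_mul]
    push_cast
    ring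

lemma norm_add_pow_four_add_norm_sub_pow_four_le (𝕜 : Type*) [RCLike 𝕜] [InnerProductSpace 𝕜 H]
    (s v : H) :
    ‖s + v‖ ^ 4 + ‖s - v‖ ^ 4 ≤ 2 * ‖s‖ ^ 4 + 12 * (‖v‖ ^ 2 * ‖s‖ ^ 2) + 2 * ‖v‖ ^ 4 := by
  have h : ‖s + v‖ ^ 2 + ‖s - v‖ ^ 2 = 2 * ‖s‖ ^ 2 + 2 * ‖v‖ ^ 2 := by
    linarith [parallelogram_law_with_norm 𝕜 s v]
  have h1 : ‖s + v‖ ^ 2 ≤ (‖s‖ + ‖v‖) ^ 2 := by gcongr; exact norm_add_le _ _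
  have h2 : ‖s - v‖ ^ 2 ≤ (‖s‖ + ‖v‖) ^ 2 := by gcongr; exact norm_sub_le _ _
  have h3 : (‖s + v‖ ^ 2 - ‖s - v‖ ^ 2) ^ 2 ≤ (4 * ‖s‖ * ‖v‖) ^ 2 := by
    apply sq_le_sq'
    · linarith [norm_nonneg s, norm_nonneg v]
    · linarith [norm_nonneg s, norm_nonneg v]
  have h4 : (‖s + v‖ ^ 2 + ‖s - v‖ ^ 2) ^ 2 = (2 * ‖s‖ ^ 2 + 2 * ‖v‖ ^ 2) ^ 2 := by rw [h]
  linarith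

/-- Fourth moment: the average of `‖∑ ± v i‖⁴` over the signs is at most `3 (∑ ‖v i‖²)²`. -/
lemma sum_powerset_norm_signedSum_pow_four_le (𝕜 : Type*) [RCLike 𝕜] [InnerProductSpace 𝕜 H]
    [DecidableEq ι] (v : ι → H) (F : Finset ι) :
    ∑ T ∈ F.powerset, ‖signedSum v F T‖ ^ 4 ≤ 2 ^ F.card * (3 * (∑ i ∈ F, ‖v i‖ ^ 2) ^ 2) := by
  induction F using Finset.induction_on with
  | empty => simp [signedSum]
  | insert j F hj ih =>
    rw [sum_powerset_insert_signedSum v (fun x => ‖x‖ ^ 4) hj]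
    refine (Finset.sum_le_sum fun T _ =>
      norm_add_pow_four_add_norm_sub_pow_four_le 𝕜 (signedSum v F T) (v j)).trans ?_
    simp only [Finset.sum_add_distrib, ← Finset.mul_sum, sum_powerset_norm_signedSum_sq 𝕜,
      Finset.sum_insert hj, Finset.card_insert_of_notMem hj, Finset.sum_const,
      Finset.card_powerset, nsmul_eq_mul]
    push_cast
    have : (0 : ℝ) ≤ 2 ^ F.card * ‖v j‖ ^ 4 := by positivity
    rw [pow_succ 2 F.card]
    linarith

/-- Lower `L_1` Khintchine inequality, with constant `2`: the first moment is bounded below by means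
of the second and the fourth. -/
theorem sqrt_sum_norm_sq_le_two_mul_average_signedSum (𝕜 : Type*) [RCLike 𝕜]
    [InnerProductSpace 𝕜 H] [DecidableEq ι] (v : ι → H) (F : Finset ι) :
    √(∑ i ∈ F, ‖v i‖ ^ 2) ≤ 2 * ∑ T ∈ F.powerset, (2 ^ F.card : ℝ)⁻¹ * ‖signedSum v F T‖ := by
  set A := √(∑ i ∈ F, ‖v i‖ ^ 2)
  have hA2 : A ^ 2 = ∑ i ∈ F, ‖v i‖ ^ 2 := Real.sq_sqrt (by positivity)
  have hA0 : 0 ≤ A := Real.sqrt_nonneg _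
  rcases hA0.eq_or_lt with h0 | hpos
  · rw [← h0]; positivity
  -- `4 / 27` is the least `c` with `u² - c u⁴ ≤ u` for all `u ≥ 0`, with equality at
  -- `u = 3 / 2`. Averaging the inequality, scaled by `A`, leaves `1 - 3 * 4 / 27 = 5 / 9 ≥ 1 / 2`.
  have hpt (u : ℝ) (hu : 0 ≤ u) : A ^ 2 * u ^ 2 - 4 / 27 * u ^ 4 ≤ A ^ 3 * u := by
    have : 0 ≤ 4 / 27 * u * ((u - 3 / 2 * A) ^ 2 * (u + 3 * A)) := by positivity
    linarith
  have hsum := Finset.sum_le_sum fun T (_ : T ∈ F.powerset) =>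
    hpt ‖signedSum v F T‖ (norm_nonneg _)
  rw [Finset.sum_sub_distrib, ← Finset.mul_sum, ← Finset.mul_sum, ← Finset.mul_sum,
    sum_powerset_norm_signedSum_sq 𝕜, ← hA2] at hsum
  have h4 := sum_powerset_norm_signedSum_pow_four_le 𝕜 v F
  rw [← hA2] at h4
  rw [← Finset.mul_sum]
  set N : ℝ := 2 ^ F.card
  have hN : 0 < N := by positivity
  set E := ∑ T ∈ F.powerset, ‖signedSum v F T‖
  have h5 : A ^ 3 * (N * A) ≤ A ^ 3 * (2 * E) := by
    have : 0 ≤ N * A ^ 4 := by positivity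
    linarith
  have h6 := le_of_mul_le_mul_left h5 (by positivity)
  rw [show 2 * (N⁻¹ * E) = (2 * E) / N by field_simp, le_div_iff₀ hN]
  linarith
end

/-! ### Cotype 2 of `L_p` for `1 ≤ p ≤ 2` -/

section
variable {α H ι : Type*} {m : MeasurableSpace α} {μ : Measure α} [NormedAddCommGroup H]
  {p : ℝ≥0∞}

/-- Jensen's inequality for `s ↦ s ^ (2 / q)` with weights `b i ^ 2 / B ^ 2`. Indices with `b i = 0`
have weight zero, and there `a i / b i` has the junk value `0`, so they do no harm. -/
lemma sum_weight_mul_div_rpow_le {ι : Type*} {q B : ℝ} (hq0 : 0 < q) (hq2 : q ≤ 2)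
    (F : Finset ι) (a b : ι → ℝ) (ha : ∀ i, 0 ≤ a i) (hb : ∀ i, 0 ≤ b i) (hB : 0 < B)
    (hB2 : B ^ 2 = ∑ i ∈ F, b i ^ 2) :
    ∑ i ∈ F, b i ^ 2 / B ^ 2 * (a i / b i) ^ q ≤ (√(∑ i ∈ F, a i ^ 2) / B) ^ q := by
  have hw1 : ∑ i ∈ F, b i ^ 2 / B ^ 2 = 1 := by
    rw [← Finset.sum_div, ← hB2]
    exact div_self (by positivity)
  have hJ : (∑ i ∈ F, b i ^ 2 / B ^ 2 * (a i / b i) ^ q) ^ (2 / q) ≤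
      ∑ i ∈ F, b i ^ 2 / B ^ 2 * (a i / b i) ^ 2 := by
    refine (Real.rpow_arith_mean_le_arith_mean_rpow F (fun i => b i ^ 2 / B ^ 2) _
      (fun i _ => by positivity) hw1
      (fun i _ => Real.rpow_nonneg (div_nonneg (ha i) (hb i)) _)
      (by rw [le_div_iff₀ hq0]; linarith)).trans_eq ?_
    refine Finset.sum_congr rfl fun i _ => ?_
    rw [← Real.rpow_mul (div_nonneg (ha i) (hb i)), mul_div_cancel₀ _ hq0.ne', Real.rpow_two]
  have hsq : ∑ i ∈ F, b i ^ 2 / B ^ 2 * (a i / b i) ^ 2 ≤ (√(∑ i ∈ F, a i ^ 2) / B) ^ 2 := by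
    rw [div_pow, Real.sq_sqrt (by positivity), Finset.sum_div]
    refine Finset.sum_le_sum fun i _ => ?_
    by_cases hi : b i = 0
    · rw [hi]; simp; positivity
    · exact le_of_eq (by field_simp)
  have hnn : 0 ≤ ∑ i ∈ F, b i ^ 2 / B ^ 2 * (a i / b i) ^ q :=
    Finset.sum_nonneg fun i _ =>
      mul_nonneg (by positivity) (Real.rpow_nonneg (div_nonneg (ha i) (hb i)) _)
  have := Real.rpow_le_rpow (Real.rpow_nonneg hnn _) (hJ.trans hsq) (z := q / 2) (by positivity)
  rwa [← Real.rpow_mul hnn, div_mul_div_cancel₀ hq0.ne', div_self two_ne_zero,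
    Real.rpow_one, ← Real.rpow_two (_ / B), ← Real.rpow_mul (by positivity),
    mul_div_cancel₀ _ two_ne_zero] at this

lemma Lp_norm_rpow_eq_integral (hp0 : p ≠ 0) (hpt : p ≠ ⊤) (g : Lp H p μ) :
    ‖g‖ ^ p.toReal = ∫ t, ‖g t‖ ^ p.toReal ∂μ := by
  have hp := ENNReal.toReal_pos hp0 hpt
  have h0 : 0 ≤ ∫ t, ‖g t‖ ^ p.toReal ∂μ := integral_nonneg fun _ => by positivity
  rw [Lp.norm_def, (Lp.memLp g).eLpNorm_eq_integral_rpow_norm hp0 hpt,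
    ENNReal.toReal_ofReal (by positivity), ← Real.rpow_mul h0, inv_mul_cancel₀ hp.ne',
    Real.rpow_one]

lemma coeFn_signedSum [DecidableEq ι] (v : ι → Lp H p μ) (F T : Finset ι) :
    (signedSum v F T : Lp H p μ) =ᵐ[μ] fun t => signedSum (fun i => v i t) F T := by
  unfold signedSum
  have hT : ∀ i, ((if i ∈ T then v i else -v i : Lp H p μ) : α → H) =ᵐ[μ]
      fun t => if i ∈ T then v i t else -v i t := by
    intro i
    split_ifs
    · rfl
    · exact Lp.coeFn_neg _
  induction F using Finset.induction_on with
  | empty => simpa using! Lp.coeFn_zero H p μ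
  | insert j F hj ih =>
    rw [Finset.sum_insert hj]
    filter_upwards [Lp.coeFn_add (if j ∈ T then v j else -v j)
      (∑ i ∈ F, if i ∈ T then v i else -v i), hT j, ih] with t h1 h2 h3
    rw [h1, Pi.add_apply, h2, h3, Finset.sum_insert hj]

/-- `L_p` has cotype 2 for `1 ≤ p ≤ 2`, stated with a common bound for the signed sums in place of
their average. -/
lemma sqrt_sum_norm_sq_le_of_norm_signedSum_le (𝕜 : Type*) [RCLike 𝕜]
    [InnerProductSpace 𝕜 H] [DecidableEq ι] [hp1 : Fact (1 ≤ p)] (hp2 : p ≤ 2)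
    (v : ι → Lp H p μ) (F : Finset ι) {R : ℝ} (hR : ∀ T ⊆ F, ‖signedSum v F T‖ ≤ R) :
    √(∑ i ∈ F, ‖v i‖ ^ 2) ≤ 2 * R := by
  have hR0 : 0 ≤ R := (norm_nonneg _).trans (hR ∅ (Finset.empty_subset F))
  have hpt : p ≠ ⊤ := ne_top_of_le_ne_top (by simp) hp2
  have hp0 : p ≠ 0 := (zero_lt_one.trans_le hp1.out).ne'
  set q := p.toReal with hq
  have hq1 : 1 ≤ q := by simpa using ENNReal.toReal_mono hpt hp1.out
  have hq2 : q ≤ 2 := by simpa using ENNReal.toReal_mono (by simp) hp2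
  have hq0 : 0 < q := by linarith
  set B := √(∑ i ∈ F, ‖v i‖ ^ 2) with hB
  have hB2 : B ^ 2 = ∑ i ∈ F, ‖v i‖ ^ 2 := Real.sq_sqrt (by positivity)
  rcases (Real.sqrt_nonneg _ : 0 ≤ √(∑ i ∈ F, ‖v i‖ ^ 2)).eq_or_lt with h0 | hpos
  · rw [hB, ← h0]; positivity
  -- With these weights, `∑ w i * (‖v i t‖ / ‖v i‖) ^ q` has integral `1`, while Jensen and
  -- Khintchine bound it pointwise by a multiple of the average of `‖∑ ± v i t‖ ^ q`.
  set w : ι → ℝ := fun i => ‖v i‖ ^ 2 / B ^ 2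
  have hw0 (i) : 0 ≤ w i := by positivity
  have hw1 : ∑ i ∈ F, w i = 1 := by
    simp only [w, ← Finset.sum_div, ← hB2]
    exact div_self (by positivity)
  set c : ℝ := (2 ^ F.card)⁻¹
  have hc0 : 0 ≤ c := by positivity
  have hc1 : ∑ _T ∈ F.powerset, c = 1 := by simp [c]
  have hpoint : ∀ᵐ t ∂μ, ∑ i ∈ F, w i * (‖v i t‖ / ‖v i‖) ^ q ≤
      (2 / B) ^ q * ∑ T ∈ F.powerset, c * ‖signedSum v F T t‖ ^ q := by
    have hs : ∀ᵐ t ∂μ, ∀ T ∈ F.powerset,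
        signedSum v F T t = signedSum (fun i => v i t) F T :=
      (Finset.eventually_all _).2 fun T _ => coeFn_signedSum v F T
    filter_upwards [hs] with t ht
    have hJ2 := sum_weight_mul_div_rpow_le hq0 hq2 F (fun i => ‖v i t‖) (fun i => ‖v i‖)
      (fun i => norm_nonneg _) (fun i => norm_nonneg _) hpos hB2
    refine hJ2.trans ?_
    have hK := sqrt_sum_norm_sq_le_two_mul_average_signedSum 𝕜 (fun i => v i t) F
    calc (√(∑ i ∈ F, ‖v i t‖ ^ 2) / B) ^ q
        ≤ ((2 * ∑ T ∈ F.powerset, c * ‖signedSum (fun i => v i t) F T‖) / B) ^ q := by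
          gcongr
      _ = (2 / B) ^ q * (∑ T ∈ F.powerset, c * ‖signedSum (fun i => v i t) F T‖) ^ q := by
          rw [← Real.mul_rpow (by positivity) (by positivity)]; congr 1; ring
      _ ≤ (2 / B) ^ q * ∑ T ∈ F.powerset, c * ‖signedSum (fun i => v i t) F T‖ ^ q := by
          gcongr
          exact Real.rpow_arith_mean_le_arith_mean_rpow _ _ _ (fun _ _ => hc0) hc1
            (fun _ _ => norm_nonneg _) hq1
      _ = _ := by
          congr 1
          exact Finset.sum_congr rfl fun T hT => by rw [ht T hT]
  have hint (g : Lp H p μ) : Integrable (fun t => ‖g t‖ ^ q) μ :=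
    (Lp.memLp g).integrable_norm_rpow hp0 hpt
  have hint' (i : ι) : Integrable (fun t => w i * (‖v i t‖ / ‖v i‖) ^ q) μ := by
    simp_rw [Real.div_rpow (norm_nonneg _) (norm_nonneg _)]
    exact ((hint (v i)).div_const _).const_mul _
  have hI := integral_mono_ae (integrable_finsetSum _ fun i _ => hint' i)
    ((integrable_finsetSum _ fun T _ => (hint (signedSum v F T)).const_mul c).const_mul
      ((2 / B) ^ q)) hpoint
  rw [integral_finsetSum _ fun i _ => hint' i, integral_const_mul,
    integral_finsetSum _ fun T _ => (hint (signedSum v F T)).const_mul c] at hI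
  simp_rw [integral_const_mul, Real.div_rpow (norm_nonneg _) (norm_nonneg _), integral_div,
    hq, ← Lp_norm_rpow_eq_integral hp0 hpt, ← hq] at hI
  have hL : ∑ i ∈ F, w i * (‖v i‖ ^ q / ‖v i‖ ^ q) = 1 := by
    rw [← hw1]
    refine Finset.sum_congr rfl fun i _ => ?_
    by_cases hi : ‖v i‖ = 0
    · simp [w, hi]
    · rw [div_self (by positivity), mul_one]
  have hU : ∑ T ∈ F.powerset, c * ‖signedSum v F T‖ ^ q ≤ R ^ q := by
    calc _ ≤ ∑ T ∈ F.powerset, c * R ^ q := by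
          refine Finset.sum_le_sum fun T hT => ?_
          gcongr
          exact hR T (Finset.mem_powerset.1 hT)
      _ = R ^ q := by rw [← Finset.sum_mul, hc1, one_mul]
  have h1 : (1 : ℝ) ≤ (2 / B * R) ^ q := by
    rw [Real.mul_rpow (by positivity) hR0, ← hL]
    exact hI.trans (by gcongr)
  have h2 : 1 ≤ 2 / B * R := by
    by_contra! h
    exact absurd h1 (not_le.2 (Real.rpow_lt_one (by positivity) h hq0))
  rw [div_mul_eq_mul_div, le_div_iff₀ hpos] at h2
  linarith
end

/-! ### Compactness from square-summability -/

section
variable {𝕜 : Type*} [RCLike 𝕜]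

/-- An operator is compact if the coordinates are bounded in `ℓ_2` by the norm and the images of the
basis vectors have square-summable norms: by Cauchy–Schwarz it is then the norm limit of its
compositions with the finite-rank basis projections. -/
lemma isCompactOperator_of_sqrt_sum_coord_sq_le {ι X Y : Type*} [NormedAddCommGroup X]
    [NormedSpace 𝕜 X] [NormedAddCommGroup Y] [NormedSpace 𝕜 Y] [CompleteSpace Y]
    (b : UnconditionalSchauderBasis ι 𝕜 X) (T : X →L[𝕜] Y) {C : ℝ}
    (hC : ∀ (x : X) (F : Finset ι), √(∑ i ∈ F, ‖b.coord i x‖ ^ 2) ≤ C * ‖x‖)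
    (hT : Summable fun i => ‖T (b i)‖ ^ 2) : IsCompactOperator T := by
  classical
  have hcomp (F : Finset ι) : IsCompactOperator (T ∘L b.proj F) := by
    have h : T ∘L b.proj F = ∑ i ∈ F, T ∘L (b.coord i).smulRight (b i) := by
      ext x; simp
    rw [h]
    refine Finset.sum_induction _ (fun S : X →L[𝕜] Y => IsCompactOperator S)
      (fun _ _ h1 h2 => h1.add h2) isCompactOperator_zero fun i _ => ?_
    -- Each summand factors through the scalar field, which is locally compact.
    have h1 : IsCompactOperator (b.coord i) := isCompactOperator_of_locallyCompactSpace_dom _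
    exact h1.clm_comp (T ∘L ContinuousLinearMap.toSpanSingleton 𝕜 (b i))
  refine isCompactOperator_of_tendsto (l := atTop) (F := fun F : Finset ι => T ∘L b.proj F) ?_
    (Eventually.of_forall hcomp)
  rw [Metric.tendsto_atTop]
  intro ε hε
  set η : ℝ := (ε / 2 / (|C| + 1)) ^ 2
  have hη0 : 0 < η := by positivity
  obtain ⟨F₀, hF₀⟩ := summable_iff_vanishing_norm.1 hT η hη0
  refine ⟨F₀, fun F hF => ?_⟩
  rw [dist_eq_norm, norm_sub_rev]
  refine (ContinuousLinearMap.opNorm_le_bound _ (half_pos hε).le fun x => ?_).trans_lt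
    (half_lt_self hε)
  have hlim : Tendsto (fun G => ‖T (b.proj G x) - T (b.proj F x)‖) atTop
      (𝓝 ‖T x - T (b.proj F x)‖) := by
    have := GeneralSchauderBasis.tendsto_proj b x
    rw [SummationFilter.unconditional_filter] at this
    exact (((T.continuous.tendsto x).comp this).sub_const _).norm
  refine le_of_tendsto hlim ?_
  filter_upwards [eventually_ge_atTop F] with G hG
  have hdiff : T (b.proj G x) - T (b.proj F x) = ∑ i ∈ G \ F, b.coord i x • T (b i) := by
    rw [← map_sub, b.proj_apply, b.proj_apply, ← Finset.sum_sdiff hG, add_sub_cancel_right]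
    simp
  have htail : √(∑ i ∈ G \ F, ‖T (b i)‖ ^ 2) ≤ ε / 2 / (|C| + 1) := by
    have := hF₀ (G \ F) (Finset.sdiff_disjoint.mono_right hF)
    rw [Real.norm_of_nonneg (by positivity)] at this
    exact Real.sqrt_le_iff.2 ⟨by positivity, this.le⟩
  rw [hdiff]
  calc ‖∑ i ∈ G \ F, b.coord i x • T (b i)‖
      ≤ ∑ i ∈ G \ F, ‖b.coord i x‖ * ‖T (b i)‖ :=
        (norm_sum_le _ _).trans_eq (by simp_rw [norm_smul])
    _ ≤ √(∑ i ∈ G \ F, ‖b.coord i x‖ ^ 2) * √(∑ i ∈ G \ F, ‖T (b i)‖ ^ 2) :=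
        Real.sum_mul_le_sqrt_mul_sqrt _ _ _
    _ ≤ ((|C| + 1) * ‖x‖) * (ε / 2 / (|C| + 1)) := by
        gcongr
        refine (hC x _).trans ?_
        gcongr
        linarith [le_abs_self C]
    _ = ε / 2 * ‖x‖ := by field_simp

/-! ### Translates restricted to a bounded set -/

/-- The translates of a bounded set by a uniformly separated family overlap boundedly often. -/
lemma exists_sum_indicator_add_le {ι : Type*} {lam : ι → ℝ} {δ : ℝ} (hδ : 0 < δ)
    (hsep : ∀ i j, i ≠ j → δ ≤ |lam i - lam j|) {I : Set ℝ} (hI : Bornology.IsBounded I) :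
    ∃ M : ℝ, ∀ (F : Finset ι) (y : ℝ), (∑ i ∈ F, I.indicator (1 : ℝ → ℝ) (y + lam i)) ≤ M := by
  classical
  obtain ⟨r, hr⟩ := hI.subset_closedBall 0
  refine ⟨|2 * r / δ| + 2, fun F y => ?_⟩
  have hcard : ∑ i ∈ F, I.indicator (1 : ℝ → ℝ) (y + lam i) =
      ({i ∈ F | y + lam i ∈ I}.card : ℝ) := by
    simp [Set.indicator_apply, Finset.sum_boole]
  have hle : {i ∈ F | y + lam i ∈ I}.card ≤
      (Finset.Icc ⌊(-r - y) / δ⌋ ⌊(r - y) / δ⌋).card := by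
    refine Finset.card_le_card_of_injOn (fun i => ⌊lam i / δ⌋) (fun i hi => ?_)
      fun i _ j _ hij => ?_
    · have h := hr (Finset.mem_filter.1 hi).2
      rw [mem_closedBall_zero_iff, Real.norm_eq_abs, abs_le] at h
      rw [Finset.coe_Icc]
      exact ⟨Int.floor_mono (by gcongr; linarith), Int.floor_mono (by gcongr; linarith)⟩
    · -- Points with the same integer part of `lam i / δ` are less than `δ` apart.
      by_contra hne
      have h := Int.abs_sub_lt_one_of_floor_eq_floor hij
      rw [← sub_div, abs_div, abs_of_pos hδ, div_lt_one hδ] at h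
      exact (hsep i j hne).not_gt h
  rw [hcard]
  refine (Nat.cast_le.2 hle).trans ?_
  rw [Int.card_Icc, ← Int.cast_natCast, Int.toNat_eq_max]
  push_cast
  refine max_le ?_ (by positivity)
  have h1 := Int.floor_le ((r - y) / δ)
  have h2 := Int.lt_floor_add_one ((-r - y) / δ)
  have h3 : (r - y) / δ - (-r - y) / δ = 2 * r / δ := by ring
  linarith [le_abs_self (2 * r / δ)]

variable {p : ℝ≥0∞}

lemma norm_translateOp (t : ℝ) (f : Lp 𝕜 p (volume : Measure ℝ)) :
    ‖translateOp t f‖ = ‖f‖ :=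
  Lp.norm_compMeasurePreserving _ _

/-- Translation is continuous on `L_p`, uniformly in its parameter since it acts by isometries. -/
lemma exists_norm_translateOp_sub_lt [Fact (1 ≤ p)] (hp : p ≠ ⊤)
    (f : Lp 𝕜 p (volume : Measure ℝ)) {ε : ℝ} (hε : 0 < ε) :
    ∃ δ > 0, ∀ s t : ℝ, |s - t| < δ →
      ‖translateOp s f - translateOp t f‖ < ε := by
  have hcont : Continuous fun t : ℝ => translateOp t f := by
    refine Continuous.compMeasurePreservingLp
      (g := fun t : ℝ => (⟨fun x : ℝ => x - t, by fun_prop⟩ : C(ℝ, ℝ)))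
      (continuous_const (y := f)) ?_
      (fun t => measurePreserving_sub_right volume t) hp
    exact ContinuousMap.continuous_of_continuous_uncurry _ (continuous_snd.sub continuous_fst)
  obtain ⟨δ, hδ, h⟩ := Metric.continuous_iff.1 hcont 0 ε hε
  refine ⟨δ, hδ, fun s t hst => ?_⟩
  have hadd (u : ℝ) : translateOp t (translateOp u f) =
      translateOp (u + t) f := by
    unfold translateOp
    rw [← Lp.compMeasurePreserving_comp_apply]
    congr 2 with x
    simp only [Function.comp_apply]
    ring
  have h1 := h (s - t) (by simpa using hst)
  rw [dist_eq_norm] at h1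
  have h2 := Lp.norm_compMeasurePreserving (translateOp (s - t) f - translateOp 0 f)
    (measurePreserving_sub_right volume t)
  rw [map_sub] at h2
  change ‖translateOp t _ - translateOp t _‖ = _ at h2
  rw [hadd, hadd, sub_add_cancel, zero_add] at h2
  rwa [h2]

/-- Restricting `T_{lam i} f` to `I` amounts to restricting `f` to `I - lam i`; when at most `M` of
these sets overlap, the `p`-th powers of the norms add up to at most `M ‖f‖ ^ p`. -/
lemma sum_norm_restrict_translateOp_rpow_le [Fact (1 ≤ p)] (hp : p ≠ ⊤) {ι : Type*}
    (f : Lp 𝕜 p (volume : Measure ℝ)) {lam : ι → ℝ} {I : Set ℝ} (hI : MeasurableSet I)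
    {F : Finset ι} {M : ℝ}
    (hM : ∀ y : ℝ, (∑ i ∈ F, I.indicator (1 : ℝ → ℝ) (y + lam i)) ≤ M) :
    ∑ i ∈ F, ‖LpToLpRestrictCLM ℝ 𝕜 𝕜 volume p I (translateOp (lam i) f)‖ ^ p.toReal
      ≤ M * ‖f‖ ^ p.toReal := by
  have hp0 : p ≠ 0 := (zero_lt_one.trans_le (Fact.out : 1 ≤ p)).ne'
  set q := p.toReal with hq
  have hint : Integrable (fun y => ‖f y‖ ^ q) := (Lp.memLp f).integrable_norm_rpow hp0 hp
  have hind (i : ι) : Measurable fun y : ℝ => I.indicator (1 : ℝ → ℝ) (y + lam i) :=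
    (measurable_one.indicator hI).comp (measurable_add_const _)
  have hbd (x : ℝ) : ‖I.indicator (1 : ℝ → ℝ) x‖ ≤ 1 := by
    by_cases h : x ∈ I <;> simp [h]
  have hint' (i : ι) : Integrable fun y => I.indicator (1 : ℝ → ℝ) (y + lam i) * ‖f y‖ ^ q :=
    hint.bdd_mul (hind i).aestronglyMeasurable (Eventually.of_forall fun y => hbd _)
  have hterm (i : ι) :
      ‖LpToLpRestrictCLM ℝ 𝕜 𝕜 volume p I (translateOp (lam i) f)‖ ^ q =
        ∫ y, I.indicator (1 : ℝ → ℝ) (y + lam i) * ‖f y‖ ^ q := by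
    rw [hq, Lp_norm_rpow_eq_integral hp0 hp]
    have h1 : ∀ᵐ x ∂(volume.restrict I), ‖LpToLpRestrictCLM ℝ 𝕜 𝕜 volume p I
        (translateOp (lam i) f) x‖ ^ p.toReal = ‖f (x - lam i)‖ ^ q := by
      filter_upwards [LpToLpRestrictCLM_coeFn 𝕜 I (translateOp (lam i) f),
        ae_restrict_of_ae (Lp.coeFn_compMeasurePreserving f
          (measurePreserving_sub_right volume (lam i)))] with x hx1 hx2
      rw [hx1, translateOp, hx2]; rfl
    rw [integral_congr_ae h1, ← integral_indicator hI,
      ← integral_sub_right_eq_self (fun y => I.indicator (1 : ℝ → ℝ) (y + lam i) * ‖f y‖ ^ q)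
        (lam i)]
    congr 1 with x
    by_cases h : x ∈ I <;> simp [h]
  simp_rw [hterm]
  rw [← integral_finsetSum _ fun i _ => hint' i, hq, Lp_norm_rpow_eq_integral hp0 hp,
    ← integral_const_mul]
  refine integral_mono (integrable_finsetSum _ fun i _ => hint' i) (hint.const_mul M) fun y => ?_
  simp only [← Finset.sum_mul]
  exact mul_le_mul_of_nonneg_right (hM y) (by positivity)
end

/-! ### Unconditional bases of translates -/

section
variable {𝕜 : Type*} [RCLike 𝕜] {p : ℝ≥0∞}

/-- If the translates form an unconditional basis, then the `lam i` are uniformly separated: the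
projection onto the `i`-th basis vector maps `T_{lam i} f - T_{lam j} f` to `T_{lam i} f`, so these
differences stay away from zero. -/
lemma exists_le_abs_sub_of_isUnconditionalBasic [Fact (1 ≤ p)] (hp : p ≠ ⊤)
    {f : Lp 𝕜 p (volume : Measure ℝ)} {lam : ℕ → ℝ}
    (b : UnconditionalSchauderBasis ℕ 𝕜 (translateSpan f lam))
    (hb : ∀ i, (b i : Lp 𝕜 p (volume : Measure ℝ)) = translateOp (lam i) f)
    (hf : 0 < ‖f‖) {K : ℝ} (hK : ∀ F : Finset ℕ, ‖b.proj F‖ ≤ K) :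
    ∃ δ > 0, ∀ i j, i ≠ j → δ ≤ |lam i - lam j| := by
  have hK0 : 0 ≤ K := (norm_nonneg (b.proj ∅)).trans (hK ∅)
  obtain ⟨δ, hδ, h⟩ := exists_norm_translateOp_sub_lt hp f
    (ε := ‖f‖ / (K + 1)) (by positivity)
  refine ⟨δ, hδ, fun i j hij => ?_⟩
  by_contra! hlt
  have h1 := h _ _ hlt
  have h2 : b.proj {i} (b i - b j) = b i := by
    simp [b.ortho, hij]
  have h3 := (b.proj {i}).le_of_opNorm_le (hK {i}) (b i - b j)
  rw [h2, Submodule.coe_norm, Submodule.coe_norm, Submodule.coe_sub, hb, hb,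
    norm_translateOp] at h3
  rw [lt_div_iff₀ (by positivity)] at h1
  nlinarith [norm_nonneg (translateOp (lam i) f - translateOp (lam j) f)]

/-- Coordinates with respect to an unconditional basis, bounded away from zero, of a subspace of
`L_p` with `1 ≤ p ≤ 2` are bounded in `ℓ_2` by the norm. Signed sums are differences of two basis
projections, which is where unconditionality enters. -/
lemma sqrt_sum_norm_coord_sq_le [Fact (1 ≤ p)] {α : Type*} {m : MeasurableSpace α}
    {μ : Measure α} (hp : p ≤ 2) {X : Submodule 𝕜 (Lp 𝕜 p μ)} {ι : Type*}
    (b : UnconditionalSchauderBasis ι 𝕜 X) {r : ℝ} (hr : 0 < r) (hb : ∀ i, r ≤ ‖b i‖) {K : ℝ}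
    (hK : ∀ F : Finset ι, ‖b.proj F‖ ≤ K) (x : X) (F : Finset ι) :
    √(∑ i ∈ F, ‖b.coord i x‖ ^ 2) ≤ 4 * K / r * ‖x‖ := by
  classical
  have hcot := sqrt_sum_norm_sq_le_of_norm_signedSum_le 𝕜 hp
    (fun i => ((b.coord i x • b i : X) : Lp 𝕜 p μ)) F (R := 2 * K * ‖x‖) fun T hT => by
      have h1 : signedSum (fun i => ((b.coord i x • b i : X) : Lp 𝕜 p μ)) F T =
          ((b.proj T x - b.proj (F \ T) x : X) : Lp 𝕜 p μ) := by
        rw [b.proj_apply, b.proj_apply, signedSum, ← Finset.sum_sdiff hT, Submodule.coe_sub,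
          Submodule.coe_sum, Submodule.coe_sum, sub_eq_neg_add, ← Finset.sum_neg_distrib]
        congr 1
        · exact Finset.sum_congr rfl fun i hi => if_neg (Finset.mem_sdiff.1 hi).2
        · exact Finset.sum_congr rfl fun i hi => if_pos hi
      rw [h1, Submodule.norm_coe]
      refine (norm_sub_le _ _).trans ?_
      linarith [(b.proj T).le_of_opNorm_le (hK T) x,
        (b.proj (F \ T)).le_of_opNorm_le (hK (F \ T)) x]
  have hlow : r * √(∑ i ∈ F, ‖b.coord i x‖ ^ 2) ≤
      √(∑ i ∈ F, ‖((b.coord i x • b i : X) : Lp 𝕜 p μ)‖ ^ 2) := by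
    refine Real.le_sqrt_of_sq_le ?_
    rw [mul_pow, Real.sq_sqrt (by positivity), Finset.mul_sum]
    refine Finset.sum_le_sum fun i _ => ?_
    rw [Submodule.norm_coe, norm_smul, mul_pow, mul_comm]
    gcongr
    exact hb i
  rw [div_mul_eq_mul_div, le_div_iff₀ hr]
  linarith

end

end TranslateLp

theorem mainTheorem7 {𝕜 : Type*} [RCLike 𝕜] (p : ℝ≥0∞) [Fact (1 ≤ p)] (hp : p ≤ 2)
    (f : Lp 𝕜 p (volume : Measure ℝ)) (lam : ℕ → ℝ)
    (hf : TranslateLp.IsUnconditionalBasic 𝕜 (fun i => TranslateLp.translateOp (lam i) f))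
    (I : Set ℝ) (hI : I.OrdConnected) (hIb : Bornology.IsBounded I) :
    IsCompactOperator (TranslateLp.restrictOp (TranslateLp.translateSpan f lam) I) := by
  have hpt : p ≠ ⊤ := ne_top_of_le_ne_top (by simp) hp
  have hp1 : 1 ≤ p.toReal := by simpa using ENNReal.toReal_mono hpt (Fact.out : 1 ≤ p)
  have hp2 : p.toReal ≤ 2 := by simpa using ENNReal.toReal_mono (by simp) hp
  obtain ⟨b', hb'⟩ := hf
  obtain ⟨b, hb⟩ : ∃ b : UnconditionalSchauderBasis ℕ 𝕜 (TranslateLp.translateSpan f lam),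
      ∀ i, (b i : Lp 𝕜 p (volume : Measure ℝ)) = TranslateLp.translateOp (lam i) f := ⟨b', hb'⟩
  have : CompleteSpace (TranslateLp.translateSpan f lam) :=
    inferInstanceAs (CompleteSpace (Submodule.topologicalClosure _))
  have hnorm (i : ℕ) : ‖b i‖ = ‖f‖ := by rw [Submodule.coe_norm, hb, TranslateLp.norm_translateOp]
  have hf0 : 0 < ‖f‖ := by
    rw [← hnorm 0, norm_pos_iff]
    exact b.linearIndependent.ne_zero 0
  obtain ⟨K, hK⟩ := b.exists_norm_proj_le
  obtain ⟨δ, hδ, hsep⟩ := TranslateLp.exists_le_abs_sub_of_isUnconditionalBasic hpt b hb hf0 hK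
  obtain ⟨M, hM⟩ := TranslateLp.exists_sum_indicator_add_le hδ hsep hIb
  refine TranslateLp.isCompactOperator_of_sqrt_sum_coord_sq_le b _
    (TranslateLp.sqrt_sum_norm_coord_sq_le hp b hf0 (fun i => (hnorm i).ge) hK) ?_
  set d : ℕ → ℝ := fun i => ‖TranslateLp.restrictOp (TranslateLp.translateSpan f lam) I (b i)‖
  have hd (i) : 0 ≤ d i := norm_nonneg _
  have hsum : Summable fun i => d i ^ p.toReal := by
    refine summable_of_sum_le (fun i => Real.rpow_nonneg (hd i) _) (c := M * ‖f‖ ^ p.toReal)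
      fun F => ?_
    refine le_trans (Finset.sum_le_sum fun i _ => le_of_eq ?_)
      (TranslateLp.sum_norm_restrict_translateOp_rpow_le hpt f hI.measurableSet (hM F))
    simp [d, TranslateLp.restrictOp, hb]
  -- Eventually `d i ≤ 1`, and then `d i ^ 2 ≤ d i ^ p` because `p ≤ 2`.
  refine Summable.of_norm_bounded_eventually_nat hsum ?_
  filter_upwards [hsum.tendsto_atTop_zero.eventually (gt_mem_nhds one_pos)] with i hi
  have hd1 : d i ≤ 1 := by
    by_contra! h
    exact (Real.one_le_rpow h.le (by linarith)).not_gt hi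
  rw [Real.norm_of_nonneg (by positivity), ← Real.rpow_two]
  exact Real.rpow_le_rpow_of_exponent_ge' (hd i) hd1 (by linarith) hp2
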